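/- Fix integers $m\ge 0$ and $0\le n\le T$. All logarithms are natural and all information quantities are in nats. **Channel.** Let $\mathcal Z(z)$ be a finite-dimensional, stable, minimum-phase linear time-invariant filter with $\mathcal Z(\infty)=1$, where $\mathcal Z^{-1}(z)$ has a minimal (controllable and observable) state-space realization $(F,G,H,1)$ of order $m$; thus all eigenvalues of $F$ and of $F-GH$ lie in the open unit disc. Let $\mathcal Z_T\in\mathbb R^{(T+1)\times(T+1)}$ be the lower-triangular Toeplitz matrix of the impulse response of $\mathcal Z(z)$ (it has unit diagonal). With channel input $u^T=(u_0,\dots,u_T)'$ the channel output is $$y^T=\mathcal Z_T^{-1}u^T+N^T,\qquad N^T\sim\mathcal N(0,I_{T+1}).$$ **Encoder.** The message $W\sim\mathcal N(0,I_{n+1})$ is independent of $N^T$. For $A\in\mathbb R^{(n+1)\times(n+1)}$ and $C\in\mathbb R^{1\times(n+1)}$ put $x_0=W$, $x_{t+1}=Ax_t$, $r_t=Cx_t$ for $0\le t\le T$. Assume that $(A,C)$ is observable, and that no eigenvalue of $A$ lies on the unit circle or is an eigenvalue of $F$. Let $\Gamma=[C',A'C',\dots,(A^{T})'C']'$, so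 that $r^T=\Gamma W$. **Feedback.** Let $\mathcal G_T\in\mathbb R^{(T+1)\times(T+1)}$ be strictly lower triangular (the feedback generator), and let $u^T=r^T+\mathcal G_T\,y^T$. Mutual information $I(X;Y)$ is the Kullback–Leibler divergence of the joint law from the product of the marginals, $I(X;Y\mid Z)$ is its conditional version, and $I(u^T\to y^T)=\sum_{t=0}^{T}I(u^t;y_t\mid y^{t-1})$ is the directed information. Let $K_y^{(T)}$ and $K_r^{(T)}$ be the covariance matrices of $y^T$ and $r^T$. **Proposition.** For all such $A,C,\mathcal G_T$, the three information quantities below are finite, the determinants are positive, and $$I(W;y^T)=I(r^T;y^T)=I(u^T\to y^T)=\tfrac12\log\det K_y^{(T)}=\tfrac12\log\det\bigl(I+\mathcal Z_T^{-1}K_r^{(T)}(\mathcal Z_T^{-1})'\bigr)=\tfrac12\log\det\bigl(I+\mathcal Z_T^{-1}\Gamma\Gamma'(\mathcal Z_T^{-1})'\bigr).$$ In particular, for fixed $A$ and $C$ this common value does not depend on $\mathcal G_T$. -/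

import Mathlib

open MeasureTheory ProbabilityTheory Matrix
open scoped ENNReal

namespace FeedbackCoding

noncomputable section

/-! ### Information measures (in nats) -/

section Information

variable {Ω α β γ : Type*} [MeasurableSpace Ω] [MeasurableSpace α] [MeasurableSpace β]
  [MeasurableSpace γ]

/-- Mutual information `I(X; Y)`: the Kullback-Leibler divergence of the joint law from the
product of the marginal laws. -/
def mutualInfo (P : Measure Ω) (X : Ω → α) (Y : Ω → β) : ℝ≥0∞ :=
  InformationTheory.klDiv (P.map fun ω => (X ω, Y ω)) ((P.map X).prod (P.map Y))

/-- Conditional mutual information `I(X; Y | Z)`: the Kullback-Leibler divergence of the law of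
`(Z, (X, Y))` from the law under which `Z` is unchanged and, given `Z`, the variables `X` and `Y`
are independent with their original conditional laws. -/
def condMutualInfo [StandardBorelSpace α] [Nonempty α] [StandardBorelSpace β] [Nonempty β]
    (P : Measure Ω) [IsFiniteMeasure P] (X : Ω → α) (Y : Ω → β) (Z : Ω → γ) : ℝ≥0∞ :=
  InformationTheory.klDiv (P.map fun ω => (Z ω, (X ω, Y ω)))
    ((P.map Z) ⊗ₘ ((condDistrib X Z P) ×ₖ (condDistrib Y Z P)))

/-- Directed information `I(u^T → y^T) = ∑_{t=0}^T I(u^t; y_t | y^{t-1})`, where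
`u^t = (u_0, …, u_t)` and `y^{t-1} = (y_0, …, y_{t-1})` (empty for `t = 0`). -/
def directedInfo {T : ℕ} (P : Measure Ω) [IsFiniteMeasure P] (u y : Ω → Fin (T + 1) → ℝ) :
    ℝ≥0∞ :=
  ∑ t : Fin (T + 1),
    condMutualInfo P (fun ω (i : Set.Iic t) => u ω i) (fun ω => y ω t)
      (fun ω (i : Set.Iio t) => y ω i)

/-- The covariance matrix of a random vector. -/
def covMatrix {ι : Type*} (P : Measure Ω) (X : Ω → ι → ℝ) : Matrix ι ι ℝ :=
  Matrix.of fun i j => cov[fun ω => X ω i, fun ω => X ω j; P]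

end Information

/-- The standard Gaussian law `𝒩(0, I_d)` on `ℝ^d`. -/
def stdNormal (d : ℕ) : Measure (Fin d → ℝ) :=
  Measure.pi fun _ => gaussianReal 0 1

/-! ### Linear systems -/

/-- All complex eigenvalues of a real square matrix. -/
def eigenvalues {d : ℕ} (M : Matrix (Fin d) (Fin d) ℝ) : Set ℂ :=
  spectrum ℂ (M.map (algebraMap ℝ ℂ))

/-- Discrete-time stability: all eigenvalues lie in the open unit disc. -/
def IsStable {d : ℕ} (M : Matrix (Fin d) (Fin d) ℝ) : Prop :=
  ∀ z ∈ eigenvalues M, ‖z‖ < 1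

/-- The matrix with rows `C, C A, …, C A^(k-1)`. -/
def obsMatrix {d : ℕ} (k : ℕ) (A : Matrix (Fin d) (Fin d) ℝ) (C : Fin d → ℝ) :
    Matrix (Fin k) (Fin d) ℝ :=
  Matrix.of fun t => C ᵥ* A ^ (t : ℕ)

/-- The matrix with columns `B, A B, …, A^(k-1) B`. -/
def ctrlMatrix {d : ℕ} (k : ℕ) (A : Matrix (Fin d) (Fin d) ℝ) (B : Fin d → ℝ) :
    Matrix (Fin d) (Fin k) ℝ :=
  Matrix.of fun i t => (A ^ (t : ℕ) *ᵥ B) i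

/-- `(A, C)` is observable. -/
def IsObservable {d : ℕ} (A : Matrix (Fin d) (Fin d) ℝ) (C : Fin d → ℝ) : Prop :=
  (obsMatrix d A C).rank = d

/-- `(A, B)` is controllable. -/
def IsControllable {d : ℕ} (A : Matrix (Fin d) (Fin d) ℝ) (B : Fin d → ℝ) : Prop :=
  (ctrlMatrix d A B).rank = d

/-- Impulse response of the single-input single-output system
`x_{t+1} = A x_t + B v_t`, `w_t = C x_t + D v_t`, at initial rest. -/
def impulseResponse {d : ℕ} (A : Matrix (Fin d) (Fin d) ℝ) (B C : Fin d → ℝ) (D : ℝ) : ℕ → ℝ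
  | 0 => D
  | k + 1 => C ⬝ᵥ (A ^ k *ᵥ B)

/-- The `(T+1) × (T+1)` lower-triangular Toeplitz matrix of an impulse response. -/
def toeplitz (T : ℕ) (h : ℕ → ℝ) : Matrix (Fin (T + 1)) (Fin (T + 1)) ℝ :=
  Matrix.of fun i j => if j ≤ i then h ((i : ℕ) - (j : ℕ)) else 0

/-! ### The channel and the coding structure -/

/-- The coloring filter `𝒵(z)` of the noise, a finite-dimensional, stable, minimum-phase linear
time-invariant system with `𝒵(∞) = 1`, given through a minimal realization `(F, G, H, 1)` of its
inverse `𝒵⁻¹(z)`. The realization induced for `𝒵(z)` itself, obtained by exchanging input and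
output, is `(F - G H, G, -H, 1)`. -/
structure Channel (m : ℕ) where
  F : Matrix (Fin m) (Fin m) ℝ
  G : Fin m → ℝ
  H : Fin m → ℝ
  /-- `𝒵` is minimum-phase. -/
  stable_F : IsStable F
  /-- `𝒵` is stable. -/
  stable_inv : IsStable (F - Matrix.vecMulVec G H)
  controllable : IsControllable F G
  observable : IsObservable F H

/-- `𝒵_T`, the lower-triangular Toeplitz matrix of the impulse response of `𝒵(z)`; the colored
noise of the channel is `Z^T = 𝒵_T N^T`. -/
def Channel.Zmat {m : ℕ} (ch : Channel m) (T : ℕ) : Matrix (Fin (T + 1)) (Fin (T + 1)) ℝ :=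
  toeplitz T (impulseResponse (ch.F - Matrix.vecMulVec ch.G ch.H) ch.G (-ch.H) 1)

/-- Standing assumptions on the encoder matrices `A` and `C`. -/
structure IsAdmissibleEncoder {m n : ℕ} (ch : Channel m)
    (A : Matrix (Fin (n + 1)) (Fin (n + 1)) ℝ) (C : Fin (n + 1) → ℝ) : Prop where
  observable : IsObservable A C
  not_unit_circle : ∀ z ∈ eigenvalues A, ‖z‖ ≠ 1
  not_eigenvalue_F : ∀ z ∈ eigenvalues A, z ∉ eigenvalues ch.F

/-- Encoder state: `x_0 = w`, `x_{t+1} = A x_t`. -/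
def encoderState {d : ℕ} (A : Matrix (Fin d) (Fin d) ℝ) (w : Fin d → ℝ) : ℕ → Fin d → ℝ
  | 0 => w
  | t + 1 => A *ᵥ encoderState A w t

/-- Encoder output `r^T` for the message `w`: `r_t = C x_t`, `t = 0, …, T`. -/
def encoderOutput {d : ℕ} (T : ℕ) (A : Matrix (Fin d) (Fin d) ℝ) (C : Fin d → ℝ)
    (w : Fin d → ℝ) : Fin (T + 1) → ℝ :=
  fun t => C ⬝ᵥ encoderState A w t

/-- The matrices that may serve as feedback generator: strictly lower triangular ones. -/
def IsFeedbackGenerator {T : ℕ} (Gen : Matrix (Fin (T + 1)) (Fin (T + 1)) ℝ) : Prop :=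
  ∀ i j, i ≤ j → Gen i j = 0

/-- The signals of the feedback loop over the horizon `0, …, T`: the channel input is
`u^T = r^T + 𝒢_T y^T` (with `r^T` the encoder output for the message `W` and `𝒢_T y^T = -r̂^T` the
feedback signal), and the channel output is `y^T = 𝒵_T⁻¹ u^T + N^T`. -/
structure IsCodingLoop {Ω : Type*} {m n T : ℕ} (ch : Channel m)
    (A : Matrix (Fin (n + 1)) (Fin (n + 1)) ℝ) (C : Fin (n + 1) → ℝ)
    (Gen : Matrix (Fin (T + 1)) (Fin (T + 1)) ℝ)
    (W : Ω → Fin (n + 1) → ℝ) (N u y : Ω → Fin (T + 1) → ℝ) : Prop where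
  input : ∀ ω, u ω = encoderOutput T A C (W ω) + Gen *ᵥ y ω
  output : ∀ ω, y ω = (ch.Zmat T)⁻¹ *ᵥ u ω + N ω

end

end FeedbackCoding

/-! Put `M = 𝒵_T⁻¹`. Feedback acts with a delay, so `M * Gen` is strictly lower triangular and the
loop solves to `y = L (M Γ W + N)` with `L = (1 - M * Gen)⁻¹` unit lower triangular. Hence `K_y = L
(1 + M Γ Γᵀ Mᵀ) Lᵀ`, and the feedback drops out of the determinant.

A unit lower triangular `V` diagonalizes `K_y`: the innovations `e = V y` are independent Gaussians
with variances `w i`, and `∏ w i = det K_y`. Every information quantity is an entropy of innovations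
minus an entropy of noise. Relative to the law of `X` times Lebesgue measure, the joint law of `(X,
y)` has the noise density at `L⁻¹ y - g X`, and the product of the marginals has the innovation
density at `V y`; both changes of variable preserve volume. The divergence is therefore `E log
p_N(N) - E log p_e(e) = ∑ ½ log (w i)`, for `X = W` and for `X = r` alike.

The `t`-th term of the directed information has the same form: `y_t` is a function of `u^t` plus
`N_t`, and also a function of `y^{t-1}` plus `e_t`. By causality `N_t` is independent of `(y^{t-1},
u^t)`, while `e_t` is independent of `y^{t-1}`, so the term equals `½ log (w t)`. The common
computation is `klDiv_map_shear`; `mutualInfo_of_gaussian_noise` and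
`condMutualInfo_of_gaussian_noise` are its two uses. -/

/-! ### Divergence between sheared product laws -/

open InformationTheory in
lemma klDiv_map_measurableEquiv {α β : Type*} [MeasurableSpace α] [MeasurableSpace β]
    (μ ν : Measure α) [IsFiniteMeasure μ] [IsFiniteMeasure ν] (e : α ≃ᵐ β) :
    klDiv (μ.map e) (ν.map e) = klDiv μ ν := by
  refine le_antisymm (klDiv_map_le μ ν e.measurable) ?_
  simpa using klDiv_map_le (μ.map e) (ν.map e) e.symm.measurable

open InformationTheory in
/-- The Kullback-Leibler divergence of two laws with positive densities. -/
lemma klDiv_of_eq_withDensity {E : Type*} [MeasurableSpace E] {ν μ₁ μ₂ : Measure E}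
    [SigmaFinite ν] [IsProbabilityMeasure μ₁] [IsProbabilityMeasure μ₂] {p q : E → ℝ}
    (hp : Measurable p) (hq : Measurable q) (hp0 : ∀ x, 0 < p x) (hq0 : ∀ x, 0 < q x)
    (h₁ : μ₁ = ν.withDensity fun x => ENNReal.ofReal (p x))
    (h₂ : μ₂ = ν.withDensity fun x => ENNReal.ofReal (q x))
    (hint : Integrable (fun x => Real.log (p x) - Real.log (q x)) μ₁) :
    klDiv μ₁ μ₂ ≠ ∞ ∧ (klDiv μ₁ μ₂).toReal = ∫ x, (Real.log (p x) - Real.log (q x)) ∂μ₁ := by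
  have hd : μ₁ = μ₂.withDensity fun x => ENNReal.ofReal (p x / q x) := by
    rw [h₁, h₂, ← withDensity_mul _ (by fun_prop) (by fun_prop)]
    congr 1
    ext x
    rw [Pi.mul_apply, ← ENNReal.ofReal_mul (hq0 x).le, mul_div_cancel₀ _ (hq0 x).ne']
  have hac : μ₁ ≪ μ₂ := hd ▸ withDensity_absolutelyContinuous _ _
  have hllr : llr μ₁ μ₂ =ᵐ[μ₁] fun x => Real.log (p x) - Real.log (q x) := by
    have h := Measure.rnDeriv_withDensity μ₂
      (f := fun x => ENNReal.ofReal (p x / q x)) (by fun_prop)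
    rw [← hd] at h
    filter_upwards [hac.ae_le h] with x hx
    rw [llr, hx, ENNReal.toReal_ofReal (div_pos (hp0 x) (hq0 x)).le,
      Real.log_div (hp0 x).ne' (hq0 x).ne']
  -- Both measures have mass one, so `klDiv` is the plain integral of the log-likelihood ratio.
  exact ⟨klDiv_ne_top hac (hint.congr hllr.symm), by
    rw [toReal_klDiv_of_measure_eq hac (by simp), integral_congr_ae hllr]⟩

/-- The density of a product law sheared along its second factor. -/
lemma map_prod_withDensity_shear {α V : Type*} [MeasurableSpace α] [MeasurableSpace V]
    (μ : Measure α) [IsProbabilityMeasure μ] (lam : Measure V) [SigmaFinite lam]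
    {q : V → ℝ≥0∞} (hq : Measurable q) [SFinite (lam.withDensity q)] {s t : α → V → V}
    (hs : Measurable (Function.uncurry s)) (ht : Measurable (Function.uncurry t))
    (hsp : ∀ a, lam.map (s a) = lam) (hts : ∀ a v, t a (s a v) = v) :
    (μ.prod (lam.withDensity q)).map (fun p => (p.1, s p.1 p.2)) =
      (μ.prod lam).withDensity (fun p => q (t p.1 p.2)) := by
  -- Each fibre map preserves `lam`, so the shear preserves `μ.prod lam` and only the density is
  -- transported.
  have hS : MeasurePreserving (fun p : α × V => (p.1, s p.1 p.2)) (μ.prod lam) (μ.prod lam) :=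
    (MeasurePreserving.id μ).skew_product hs (ae_of_all _ hsp)
  have hq' : Measurable fun p : α × V => q (t p.1 p.2) := hq.comp ht
  rw [prod_withDensity_right hq]
  ext A hA
  rw [Measure.map_apply hS.measurable hA, withDensity_apply _ (hS.measurable hA),
    withDensity_apply _ hA, ← hS.setLIntegral_comp_preimage hA hq']
  simp [hts]

open InformationTheory in
/-- The divergence between two sheared product laws that share their first marginal. -/
lemma klDiv_map_shear {Ω α V : Type*} [MeasurableSpace Ω] [MeasurableSpace α]
    [MeasurableSpace V] {P : Measure Ω} [IsProbabilityMeasure P] {lam ρ₁ ρ₂ : Measure V}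
    [SigmaFinite lam] [IsProbabilityMeasure ρ₁] [IsProbabilityMeasure ρ₂]
    {q₁ q₂ : V → ℝ} (hq₁ : Measurable q₁) (hq₂ : Measurable q₂)
    (hq₁0 : ∀ x, 0 < q₁ x) (hq₂0 : ∀ x, 0 < q₂ x)
    (hρ₁ : ρ₁ = lam.withDensity fun x => ENNReal.ofReal (q₁ x))
    (hρ₂ : ρ₂ = lam.withDensity fun x => ENNReal.ofReal (q₂ x))
    {s₁ t₁ s₂ t₂ : α → V → V}
    (hs₁ : Measurable (Function.uncurry s₁)) (ht₁ : Measurable (Function.uncurry t₁))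
    (hs₂ : Measurable (Function.uncurry s₂)) (ht₂ : Measurable (Function.uncurry t₂))
    (hsp₁ : ∀ a, lam.map (s₁ a) = lam) (hts₁ : ∀ a v, t₁ a (s₁ a v) = v)
    (hsp₂ : ∀ a, lam.map (s₂ a) = lam) (hts₂ : ∀ a v, t₂ a (s₂ a v) = v)
    {A : Ω → α} {N e Y : Ω → V} (hA : AEMeasurable A P) (hN : HasLaw N ρ₁ P)
    (hAN : IndepFun A N P) (hY : ∀ ω, Y ω = s₁ (A ω) (N ω)) (he : ∀ ω, t₂ (A ω) (Y ω) = e ω)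
    (hi₁ : Integrable (fun ω => Real.log (q₁ (N ω))) P)
    (hi₂ : Integrable (fun ω => Real.log (q₂ (e ω))) P) {ref : Measure (α × V)}
    (href : ref = ((P.map A).prod ρ₂).map fun p => (p.1, s₂ p.1 p.2)) :
    klDiv (P.map fun ω => (A ω, Y ω)) ref ≠ ∞ ∧
      (klDiv (P.map fun ω => (A ω, Y ω)) ref).toReal =
        ∫ ω, Real.log (q₁ (N ω)) ∂P - ∫ ω, Real.log (q₂ (e ω)) ∂P := by
  have hNm := hN.aemeasurable
  have : IsProbabilityMeasure (P.map A) := Measure.isProbabilityMeasure_map hA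
  have hS₁ : Measurable fun p : α × V => (p.1, s₁ p.1 p.2) := measurable_fst.prodMk hs₁
  have hS₂ : Measurable fun p : α × V => (p.1, s₂ p.1 p.2) := measurable_fst.prodMk hs₂
  have hAY : (fun ω => (A ω, Y ω)) =
      (fun p : α × V => (p.1, s₁ p.1 p.2)) ∘ fun ω => (A ω, N ω) := by
    ext ω <;> simp [hY]
  have hAYm : AEMeasurable (fun ω => (A ω, Y ω)) P :=
    hAY ▸ hS₁.comp_aemeasurable (hA.prodMk hNm)
  have hlaw : P.map (fun ω => (A ω, Y ω)) =
      ((P.map A).prod ρ₁).map fun p => (p.1, s₁ p.1 p.2) := by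
    rw [hAY, ← AEMeasurable.map_map_of_aemeasurable hS₁.aemeasurable (hA.prodMk hNm),
      hAN.map_prod_eq_prod_map_map hA hNm, hN.map_eq]
  have : IsProbabilityMeasure (P.map fun ω => (A ω, Y ω)) :=
    Measure.isProbabilityMeasure_map hAYm
  have : IsProbabilityMeasure ref :=
    href ▸ Measure.isProbabilityMeasure_map hS₂.aemeasurable
  have hm₁ : Measurable fun p : α × V => q₁ (t₁ p.1 p.2) := hq₁.comp ht₁
  have hm₂ : Measurable fun p : α × V => q₂ (t₂ p.1 p.2) := hq₂.comp ht₂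
  have : SFinite (lam.withDensity fun x => ENNReal.ofReal (q₁ x)) := hρ₁ ▸ inferInstance
  have : SFinite (lam.withDensity fun x => ENNReal.ofReal (q₂ x)) := hρ₂ ▸ inferInstance
  have hd₁ : P.map (fun ω => (A ω, Y ω)) = ((P.map A).prod lam).withDensity
      fun p => ENNReal.ofReal (q₁ (t₁ p.1 p.2)) := by
    rw [hlaw, hρ₁]
    exact map_prod_withDensity_shear _ lam (by fun_prop) hs₁ ht₁ hsp₁ hts₁
  have hd₂ : ref = ((P.map A).prod lam).withDensity
      fun p => ENNReal.ofReal (q₂ (t₂ p.1 p.2)) := by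
    rw [href, hρ₂]
    exact map_prod_withDensity_shear _ lam (by fun_prop) hs₂ ht₂ hsp₂ hts₂
  have hm : Measurable fun p : α × V =>
      Real.log (q₁ (t₁ p.1 p.2)) - Real.log (q₂ (t₂ p.1 p.2)) := hm₁.log.sub hm₂.log
  -- At a sample point the inverse shears recover the noise `N` and the innovation `e`, so the
  -- log-likelihood ratio splits into two entropy integrands.
  have hcomp : (fun ω => Real.log (q₁ (t₁ (A ω) (Y ω))) - Real.log (q₂ (t₂ (A ω) (Y ω)))) =
      fun ω => Real.log (q₁ (N ω)) - Real.log (q₂ (e ω)) := by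
    ext ω; rw [he, hY, hts₁]
  have hint : Integrable (fun p : α × V =>
      Real.log (q₁ (t₁ p.1 p.2)) - Real.log (q₂ (t₂ p.1 p.2)))
      (P.map fun ω => (A ω, Y ω)) := by
    rw [integrable_map_measure hm.aestronglyMeasurable hAYm]
    exact (hi₁.sub hi₂).congr (ae_of_all _ fun ω => (congrFun hcomp ω).symm)
  obtain ⟨h1, h2⟩ := klDiv_of_eq_withDensity hm₁ hm₂ (fun _ => hq₁0 _) (fun _ => hq₂0 _)
    hd₁ hd₂ hint
  refine ⟨h1, ?_⟩
  rw [h2, integral_map hAYm hm.aestronglyMeasurable, ← integral_sub hi₁ hi₂]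
  exact congrArg (fun f => ∫ ω, f ω ∂P) hcomp

/-! ### Gaussian densities and entropies -/

open scoped NNReal in
lemma gaussianReal_zero_eq_withDensity {v : ℝ≥0} (hv : v ≠ 0) :
    gaussianReal 0 v = volume.withDensity fun x => ENNReal.ofReal (gaussianPDFReal 0 v x) :=
  gaussianReal_of_var_ne_zero 0 hv

open scoped NNReal in
lemma pi_gaussianReal_eq_withDensity {ι : Type*} [Fintype ι] {v : ι → ℝ≥0}
    (hv : ∀ i, v i ≠ 0) :
    Measure.pi (fun i => gaussianReal 0 (v i)) =
      volume.withDensity fun x => ENNReal.ofReal (∏ i, gaussianPDFReal 0 (v i) (x i)) := by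
  refine Measure.pi_eq (μ := fun i => gaussianReal 0 (v i)) fun s hs => ?_
  have h0 : ∀ x : ι → ℝ, 0 ≤ ∏ i, gaussianPDFReal 0 (v i) (x i) := fun x =>
    Finset.prod_nonneg fun i _ => gaussianPDFReal_nonneg _ _ _
  rw [withDensity_apply _ (MeasurableSet.univ_pi hs), volume_pi, Measure.restrict_pi_pi,
    ← ofReal_integral_eq_lintegral_ofReal _ (ae_of_all _ h0),
    integral_fintype_prod_eq_prod (fun i x => gaussianPDFReal 0 (v i) x),
    ENNReal.ofReal_prod_of_nonneg fun i _ => integral_nonneg fun x =>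
      gaussianPDFReal_nonneg _ _ _]
  · exact Finset.prod_congr rfl fun i _ => (gaussianReal_apply_eq_integral 0 (hv i) (s i)).symm
  · exact Integrable.fintype_prod (f := fun i x => gaussianPDFReal 0 (v i) x)
      fun i => (integrable_gaussianPDFReal 0 (v i)).restrict

open scoped NNReal in
lemma log_gaussianPDFReal_zero {v : ℝ≥0} (hv : v ≠ 0) (x : ℝ) :
    Real.log (gaussianPDFReal 0 v x) =
      -(1 / 2 * Real.log (2 * Real.pi)) - 1 / 2 * Real.log v - (2 * (v : ℝ))⁻¹ * x ^ 2 := by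
  have hv' : (0 : ℝ) < v := by positivity
  rw [gaussianPDFReal, Real.log_mul (by positivity) (Real.exp_pos _).ne', Real.log_exp,
    Real.log_inv, Real.log_sqrt (by positivity), Real.log_mul (by positivity) hv'.ne']
  field_simp
  ring

open scoped NNReal in
/-- The differential entropy of a centred Gaussian variable. -/
lemma integral_log_gaussianPDFReal {Ω : Type*} [MeasurableSpace Ω] {P : Measure Ω} {v : ℝ≥0}
    (hv : v ≠ 0) {N : Ω → ℝ} (hN : HasLaw N (gaussianReal 0 v) P) :
    Integrable (fun ω => Real.log (gaussianPDFReal 0 v (N ω))) P ∧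
      ∫ ω, Real.log (gaussianPDFReal 0 v (N ω)) ∂P =
        -(1 / 2 * Real.log (2 * Real.pi)) - 1 / 2 * Real.log v - 1 / 2 := by
  have := hN.isProbabilityMeasure
  have hv' : (0 : ℝ) < v := by positivity
  have hsq : Integrable (fun x : ℝ => x ^ 2) (gaussianReal 0 v) :=
    (memLp_id_gaussianReal' 2 (by simp)).integrable_sq
  have hsqN : Integrable (fun ω => N ω ^ 2) P := by
    rw [← hN.map_eq] at hsq
    exact hsq.comp_aemeasurable hN.aemeasurable
  have hval : ∫ ω, N ω ^ 2 ∂P = v := by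
    have h := variance_fun_id_gaussianReal (μ := 0) (v := v)
    rw [variance_of_integral_eq_zero aemeasurable_id' (integral_id_gaussianReal)] at h
    rw [← h]
    exact hN.integral_comp (f := fun x => x ^ 2) (by fun_prop)
  simp_rw [log_gaussianPDFReal_zero hv]
  refine ⟨(integrable_const _).sub (hsqN.const_mul _), ?_⟩
  rw [integral_sub (integrable_const _) (hsqN.const_mul _), integral_const_mul, hval]
  simp
  field_simp

open scoped NNReal in
/-- The differential entropy of a vector of independent centred Gaussian variables. -/
lemma integral_log_prod_gaussianPDFReal {Ω ι : Type*} [MeasurableSpace Ω] [Fintype ι]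
    {P : Measure Ω} {v : ι → ℝ≥0} (hv : ∀ i, v i ≠ 0) {N : Ω → ι → ℝ}
    (hN : HasLaw N (Measure.pi fun i => gaussianReal 0 (v i)) P) :
    Integrable (fun ω => Real.log (∏ i, gaussianPDFReal 0 (v i) (N ω i))) P ∧
      ∫ ω, Real.log (∏ i, gaussianPDFReal 0 (v i) (N ω i)) ∂P =
        ∑ i, (-(1 / 2 * Real.log (2 * Real.pi)) - 1 / 2 * Real.log (v i) - 1 / 2) := by
  have h := fun i => integral_log_gaussianPDFReal (hv i)
    ((measurePreserving_eval (fun i => gaussianReal 0 (v i)) i).fun_comp_hasLaw hN)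
  have hlog : ∀ ω, Real.log (∏ i, gaussianPDFReal 0 (v i) (N ω i)) =
      ∑ i, Real.log (gaussianPDFReal 0 (v i) (N ω i)) := fun ω =>
    Real.log_prod fun i _ => (gaussianPDFReal_pos _ _ _ (hv i)).ne'
  simp_rw [hlog]
  refine ⟨integrable_finsetSum _ fun i _ => (h i).1, ?_⟩
  rw [integral_finsetSum _ fun i _ => (h i).1]
  exact Finset.sum_congr rfl fun i _ => (h i).2

lemma map_mulVec_volume {ι : Type*} [Fintype ι] [DecidableEq ι] {M : Matrix ι ι ℝ}
    (hM : M.det = 1) : Measure.map (fun x => M *ᵥ x) volume = volume := by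
  have h := Real.map_matrix_volume_pi_eq_smul_volume_pi (M := M) (by simp [hM])
  simp only [hM, inv_one, abs_one, ENNReal.ofReal_one, one_smul] at h
  exact h

/-! ### Mutual information in Gaussian noise -/

namespace FeedbackCoding

open scoped NNReal in
/-- The mutual information between a random variable and a linear observation of it in additive
Gaussian noise, when the whitened observation has independent components. -/
lemma mutualInfo_of_gaussian_noise {Ω α ι : Type*} [MeasurableSpace Ω] [MeasurableSpace α]
    [Fintype ι] [DecidableEq ι] {P : Measure Ω} [IsProbabilityMeasure P] {v w : ι → ℝ≥0}
    (hv : ∀ i, v i ≠ 0) (hw : ∀ i, w i ≠ 0) {X : Ω → α} {N e Y : Ω → ι → ℝ}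
    (hX : AEMeasurable X P) (hN : HasLaw N (Measure.pi fun i => gaussianReal 0 (v i)) P)
    (he : HasLaw e (Measure.pi fun i => gaussianReal 0 (w i)) P) (hXN : IndepFun X N P)
    {g : α → ι → ℝ} (hg : Measurable g) {L V : Matrix ι ι ℝ} (hL : L.det = 1) (hV : V.det = 1)
    (hY : ∀ ω, Y ω = L *ᵥ (g (X ω) + N ω)) (heY : ∀ ω, e ω = V *ᵥ Y ω) :
    mutualInfo P X Y ≠ ∞ ∧ (mutualInfo P X Y).toReal =
      ∑ i, (1 / 2 * Real.log (w i) - 1 / 2 * Real.log (v i)) := by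
  have hLu : IsUnit L.det := by simp [hL]
  have hVu : IsUnit V.det := by simp [hV]
  obtain ⟨i₁, j₁⟩ := integral_log_prod_gaussianPDFReal hv hN
  obtain ⟨i₂, j₂⟩ := integral_log_prod_gaussianPDFReal hw he
  have hmul : ∀ M : Matrix ι ι ℝ, Measurable fun x => M *ᵥ x := fun M =>
    (continuous_const.matrix_mulVec continuous_id).measurable
  have hinv : ∀ ω, V⁻¹ *ᵥ e ω = Y ω := fun ω => by
    rw [heY, mulVec_mulVec, nonsing_inv_mul _ hVu, one_mulVec]
  -- The marginal of `Y` is an image of the innovation law, so the product of the marginals is a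
  -- shear that ignores the first coordinate.
  have hYlaw : P.map Y = (Measure.pi fun i => gaussianReal 0 (w i)).map fun x => V⁻¹ *ᵥ x := by
    rw [← he.map_eq, AEMeasurable.map_map_of_aemeasurable (hmul _).aemeasurable he.aemeasurable]
    congr 1
    ext ω : 1
    exact (hinv ω).symm
  have hpm : IsProbabilityMeasure (P.map X) := Measure.isProbabilityMeasure_map hX
  have key := klDiv_map_shear (P := P) (lam := (volume : Measure (ι → ℝ)))
    (ρ₁ := Measure.pi fun i => gaussianReal 0 (v i))
    (ρ₂ := Measure.pi fun i => gaussianReal 0 (w i))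
    (q₁ := fun x => ∏ i, gaussianPDFReal 0 (v i) (x i))
    (q₂ := fun x => ∏ i, gaussianPDFReal 0 (w i) (x i))
    (Finset.measurable_fun_prod _ fun i _ =>
      (measurable_gaussianPDFReal _ _).comp (measurable_pi_apply i))
    (Finset.measurable_fun_prod _ fun i _ =>
      (measurable_gaussianPDFReal _ _).comp (measurable_pi_apply i))
    (fun x => Finset.prod_pos fun i _ => gaussianPDFReal_pos _ _ _ (hv i))
    (fun x => Finset.prod_pos fun i _ => gaussianPDFReal_pos _ _ _ (hw i))
    (pi_gaussianReal_eq_withDensity hv) (pi_gaussianReal_eq_withDensity hw)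
    (s₁ := fun a x => L *ᵥ (g a + x)) (t₁ := fun a y => L⁻¹ *ᵥ y - g a)
    (s₂ := fun _ x => V⁻¹ *ᵥ x) (t₂ := fun _ y => V *ᵥ y)
    ((hmul L).comp ((hg.comp measurable_fst).add measurable_snd))
    (((hmul _).comp measurable_snd).sub (hg.comp measurable_fst))
    ((hmul _).comp measurable_snd) ((hmul _).comp measurable_snd)
    (fun a => by
      have h := Measure.map_map (μ := (volume : Measure (ι → ℝ))) (hmul L)
        (measurable_const_add (g a))
      rw [map_add_left_eq_self, map_mulVec_volume hL] at h
      exact h.symm)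
    (fun a x => by
      simp only [mulVec_mulVec, nonsing_inv_mul _ hLu, one_mulVec, add_sub_cancel_left])
    (fun a => map_mulVec_volume (by rw [det_nonsing_inv, hV, Ring.inverse_one]))
    (fun a x => by simp only [mulVec_mulVec, mul_nonsing_inv _ hVu, one_mulVec])
    hX hN hXN hY (fun ω => (heY ω).symm) i₁ i₂
    (ref := (P.map X).prod (P.map Y)) (by
      rw [hYlaw]
      have h := Measure.map_prod_map (P.map X) (Measure.pi fun i => gaussianReal 0 (w i))
        measurable_id (hmul V⁻¹)
      rw [Measure.map_id] at h
      exact h)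
  refine ⟨key.1, key.2.trans ?_⟩
  rw [j₁, j₂, ← Finset.sum_sub_distrib]
  exact Finset.sum_congr rfl fun i _ => by ring

open scoped NNReal in
/-- The conditional mutual information between `X` and `Y` given `Z`, when `Y` is a function of
`X` in additive Gaussian noise, and also a function of `Z` plus a Gaussian innovation. -/
lemma condMutualInfo_of_gaussian_noise {Ω α γ : Type*} [MeasurableSpace Ω] [MeasurableSpace α]
    [StandardBorelSpace α] [Nonempty α] [MeasurableSpace γ] {P : Measure Ω}
    [IsProbabilityMeasure P] {v w : ℝ≥0} (hv : v ≠ 0) (hw : w ≠ 0) {X : Ω → α} {Z : Ω → γ}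
    {N e Y : Ω → ℝ} (hX : AEMeasurable X P) (hZ : AEMeasurable Z P)
    (hN : HasLaw N (gaussianReal 0 v) P) (he : HasLaw e (gaussianReal 0 w) P)
    (hZXN : IndepFun (fun ω => (Z ω, X ω)) N P) (hZe : IndepFun Z e P)
    {g : α → ℝ} {h : γ → ℝ} (hg : Measurable g) (hh : Measurable h)
    (hY : ∀ ω, Y ω = g (X ω) + N ω) (hYe : ∀ ω, Y ω = h (Z ω) + e ω) :
    condMutualInfo P X Y Z ≠ ∞ ∧ (condMutualInfo P X Y Z).toReal =
      1 / 2 * Real.log w - 1 / 2 * Real.log v := by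
  obtain ⟨i₁, j₁⟩ := integral_log_gaussianPDFReal hv hN
  obtain ⟨i₂, j₂⟩ := integral_log_gaussianPDFReal hw he
  have hYm : AEMeasurable Y P := by
    rw [show Y = fun ω => h (Z ω) + e ω from funext hYe]
    exact (hh.comp_aemeasurable hZ).add he.aemeasurable
  -- The base variable is the pair `(Z, X)`: the joint law is a translation by `g X`, the reference
  -- law a translation by `h Z`.
  have key := klDiv_map_shear (P := P) (lam := (volume : Measure ℝ))
    (ρ₁ := gaussianReal 0 v) (ρ₂ := gaussianReal 0 w)
    (measurable_gaussianPDFReal 0 v) (measurable_gaussianPDFReal 0 w)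
    (gaussianPDFReal_pos _ _ · hv) (gaussianPDFReal_pos _ _ · hw)
    (gaussianReal_zero_eq_withDensity hv) (gaussianReal_zero_eq_withDensity hw)
    (s₁ := fun (a : γ × α) x => g a.2 + x) (t₁ := fun a y => y - g a.2)
    (s₂ := fun a x => h a.1 + x) (t₂ := fun a y => y - h a.1)
    (by fun_prop) (by fun_prop) (by fun_prop) (by fun_prop)
    (fun a => map_add_left_eq_self _ _) (fun a x => by ring)
    (fun a => map_add_left_eq_self _ _) (fun a x => by ring)
    (hZ.prodMk hX) hN hZXN hY (fun ω => by simp [hYe]) i₁ i₂ rfl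
  have hprob : IsProbabilityMeasure (P.map Z) := Measure.isProbabilityMeasure_map hZ
  have hprob' : IsProbabilityMeasure (P.map fun ω => (Z ω, X ω)) :=
    Measure.isProbabilityMeasure_map (hZ.prodMk hX)
  have hs : Measurable fun p : (γ × α) × ℝ => (p.1, h p.1.1 + p.2) := by fun_prop
  have hk : Measurable fun p : γ × ℝ => (p.1, h p.1 + p.2) := by fun_prop
  have hjoint : P.map (fun ω => (Z ω, Y ω)) =
      ((P.map Z).prod (gaussianReal 0 w)).map fun p => (p.1, h p.1 + p.2) := by
    rw [← he.map_eq, ← hZe.map_prod_eq_prod_map_map hZ he.aemeasurable,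
      AEMeasurable.map_map_of_aemeasurable hk.aemeasurable (hZ.prodMk he.aemeasurable)]
    congr 1
    ext ω : 1
    simp [hYe]
  -- Since `e` is independent of `Z`, the conditional law of `Y` given `Z = z` is Gaussian with mean
  -- `h z` and variance `w`.
  let η : Kernel γ ℝ := ⟨fun z => gaussianReal (h z) w, by fun_prop⟩
  have hηz : ∀ z, η z = (gaussianReal 0 w).map fun x => h z + x := fun z => by
    rw [gaussianReal_map_const_add, zero_add]; rfl
  have : IsMarkovKernel η := ⟨fun z => by
    change IsProbabilityMeasure (gaussianReal (h z) w); infer_instance⟩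
  have hη : condDistrib Y Z P =ᵐ[P.map Z] η := by
    refine condDistrib_ae_eq_of_measure_eq_compProd Z hYm ?_
    rw [hjoint]
    refine Measure.ext_of_lintegral _ fun f hf => ?_
    rw [lintegral_map hf hk, lintegral_prod _ (by fun_prop),
      Measure.lintegral_compProd hf]
    refine lintegral_congr fun z => ?_
    rw [hηz, lintegral_map (by fun_prop) (by fun_prop)]
  -- Integrating the conditional law of `X` against the law of `Z` restores the law of `(Z, X)`;
  -- what remains is the shear by `h`, up to reassociating the triple.
  have href : ((P.map Z) ⊗ₘ ((condDistrib X Z P) ×ₖ (condDistrib Y Z P))) =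
      (((P.map fun ω => (Z ω, X ω)).prod (gaussianReal 0 w)).map
        fun p => (p.1, h p.1.1 + p.2)).map MeasurableEquiv.prodAssoc := by
    refine Measure.ext_of_lintegral _ fun f hf => ?_
    rw [lintegral_map_equiv, lintegral_map (by fun_prop) hs, lintegral_prod _ (by fun_prop),
      ← compProd_map_condDistrib hX, Measure.lintegral_compProd hf,
      Measure.lintegral_compProd (by fun_prop)]
    refine lintegral_congr_ae ?_
    filter_upwards [hη] with z hz
    rw [Kernel.prod_apply, hz, lintegral_prod _ (by fun_prop)]
    refine lintegral_congr fun x => ?_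
    rw [hηz, lintegral_map (by fun_prop) (by fun_prop)]
    rfl
  have hleft : P.map (fun ω => (Z ω, (X ω, Y ω))) =
      (P.map fun ω => ((Z ω, X ω), Y ω)).map MeasurableEquiv.prodAssoc := by
    rw [AEMeasurable.map_map_of_aemeasurable MeasurableEquiv.prodAssoc.measurable.aemeasurable
      ((hZ.prodMk hX).prodMk hYm)]
    rfl
  rw [condMutualInfo, href, hleft, klDiv_map_measurableEquiv]
  exact ⟨key.1, key.2.trans (by rw [j₁, j₂]; ring)⟩

end FeedbackCoding

/-! ### Triangular diagonalization of the covariance -/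

open scoped NNReal in
/-- A positive definite matrix is diagonalized by a unit lower triangular congruence. -/
lemma Matrix.PosDef.exists_isLowerTriangular_conj_eq_diagonal {d : ℕ}
    {S : Matrix (Fin d) (Fin d) ℝ} (hS : S.PosDef) :
    ∃ (V : Matrix (Fin d) (Fin d) ℝ) (w : Fin d → ℝ≥0), V.IsLowerTriangular ∧ V.det = 1 ∧
      (∀ i, V i i = 1) ∧ (∀ i, w i ≠ 0) ∧ V * S * Vᵀ = diagonal fun i => (w i : ℝ) := by
  have hlow : (LDL.lowerInv hS).IsLowerTriangular := fun i j hij =>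
    LDL.lowerInv_triangular hS hij
  have hdiag : ∀ i, LDL.lowerInv hS i i ≠ 0 := by
    have h := (Matrix.isUnit_det_of_invertible (LDL.lowerInv hS)).ne_zero
    rw [det_of_isLowerTriangular _ hlow, Finset.prod_ne_zero_iff] at h
    exact fun i => h i (Finset.mem_univ i)
  -- Rescaling the rows of the LDL factor makes its diagonal equal to one; the squared factors are
  -- absorbed into `w`.
  let c : Fin d → ℝ := fun i => (LDL.lowerInv hS i i)⁻¹
  let V := diagonal c * LDL.lowerInv hS
  have hVlow : V.IsLowerTriangular := (blockTriangular_diagonal c).mul hlow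
  have hV1 : ∀ i, V i i = 1 := fun i => by
    simp only [V, c, diagonal_mul]
    exact inv_mul_cancel₀ (hdiag i)
  have hVdet : V.det = 1 := by simp [det_of_isLowerTriangular _ hVlow, hV1]
  have hVS : V * S * Vᵀ = diagonal fun i => c i * LDL.diagEntries hS i * c i := by
    have h := LDL.diag_eq_lowerInv_conj hS
    rw [conjTranspose_eq_transpose_of_trivial] at h
    calc V * S * Vᵀ
        = diagonal c * (LDL.lowerInv hS * S * (LDL.lowerInv hS)ᵀ) * diagonal c := by
          simp only [V, transpose_mul, diagonal_transpose, Matrix.mul_assoc]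
      _ = _ := by rw [← h, LDL.diag, diagonal_mul_diagonal, diagonal_mul_diagonal]
  have hpos : (V * S * Vᵀ).PosDef := by
    have h := hS.mul_mul_conjTranspose_same (B := V)
      (vecMul_injective_iff_isUnit.2 ((isUnit_iff_isUnit_det V).2 (by simp [hVdet])))
    rwa [conjTranspose_eq_transpose_of_trivial] at h
  rw [hVS, posDef_diagonal_iff] at hpos
  refine ⟨V, fun i => ⟨_, (hpos i).le⟩, hVlow, hVdet, hV1, fun i h => ?_, hVS⟩
  exact (hpos i).ne' (congrArg NNReal.toReal h)

lemma Matrix.inv_isLowerTriangular {d : ℕ} {M : Matrix (Fin d) (Fin d) ℝ}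
    (hM : M.IsLowerTriangular) (hdet : M.det = 1) :
    M⁻¹.IsLowerTriangular ∧ M⁻¹.det = 1 := by
  have : Invertible M := M.invertibleOfIsUnitDet (by simp [hdet])
  exact ⟨blockTriangular_inv_of_blockTriangular hM, by
    rw [det_nonsing_inv, hdet, Ring.inverse_one]⟩

/-! ### Linear images of a standard Gaussian vector -/

namespace FeedbackCoding

lemma cov_mulVec {Ω ι ι' κ : Type*} [MeasurableSpace Ω] [Fintype κ] {P : Measure Ω}
    [IsProbabilityMeasure P] {ξ : Ω → κ → ℝ} (hξ : ∀ k, MemLp (fun ω => ξ ω k) 2 P)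
    (R : Matrix ι κ ℝ) (Q : Matrix ι' κ ℝ) (i : ι) (j : ι') :
    cov[fun ω => (R *ᵥ ξ ω) i, fun ω => (Q *ᵥ ξ ω) j; P] = (R * covMatrix P ξ * Qᵀ) i j := by
  simp only [mulVec, dotProduct]
  rw [covariance_fun_sum_fun_sum (fun k => (hξ k).const_mul _) fun k => (hξ k).const_mul _]
  simp_rw [covariance_const_mul_left, covariance_const_mul_right, Matrix.mul_apply,
    Finset.sum_mul, transpose_apply, covMatrix, of_apply]
  rw [Finset.sum_comm]
  exact Finset.sum_congr rfl fun _ _ => Finset.sum_congr rfl fun _ _ => by ring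

/-- A family of jointly Gaussian, uncorrelated, centred and normalized random variables. -/
structure IsStdGaussian {Ω κ : Type*} [MeasurableSpace Ω] [Fintype κ] [DecidableEq κ]
    (P : Measure Ω) (ξ : Ω → κ → ℝ) : Prop where
  gaussian : HasGaussianLaw ξ P
  mean : ∀ k, ∫ ω, ξ ω k ∂P = 0
  cov : covMatrix P ξ = 1

namespace IsStdGaussian

variable {Ω κ : Type*} [MeasurableSpace Ω] [Fintype κ] [DecidableEq κ] {P : Measure Ω}
  {ξ : Ω → κ → ℝ}

lemma memLp (hξ : IsStdGaussian P ξ) (k : κ) : MemLp (fun ω => ξ ω k) 2 P :=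
  (hξ.gaussian.eval k).memLp_two

lemma hasGaussianLaw_mulVec (hξ : IsStdGaussian P ξ) {ι : Type*} [Fintype ι]
    (R : Matrix ι κ ℝ) : HasGaussianLaw (fun ω => R *ᵥ ξ ω) P :=
  hξ.gaussian.map_fun (LinearMap.toContinuousLinearMap R.mulVecLin)

lemma covMatrix_mulVec [IsProbabilityMeasure P] (hξ : IsStdGaussian P ξ) {ι : Type*} (R : Matrix ι κ ℝ) :
    covMatrix P (fun ω => R *ᵥ ξ ω) = R * Rᵀ := by
  ext i j
  simp only [covMatrix, of_apply]
  rw [cov_mulVec hξ.memLp, hξ.cov, Matrix.mul_one]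

/-- `R * Qᵀ` is the cross-covariance of the two images, and jointly Gaussian uncorrelated vectors
are independent. -/
lemma indepFun_mulVec [IsProbabilityMeasure P] (hξ : IsStdGaussian P ξ) {ι ι' : Type*} [Fintype ι] [Fintype ι']
    {R : Matrix ι κ ℝ} {Q : Matrix ι' κ ℝ} (h : R * Qᵀ = 0) :
    IndepFun (fun ω => R *ᵥ ξ ω) (fun ω => Q *ᵥ ξ ω) P := by
  refine HasGaussianLaw.indepFun_of_covariance_eval (X := fun i ω => (R *ᵥ ξ ω) i)
    (Y := fun i ω => (Q *ᵥ ξ ω) i) ?_ fun i j => ?_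
  · exact hξ.gaussian.map_fun (LinearMap.toContinuousLinearMap (R.mulVecLin.prod Q.mulVecLin))
  · rw [cov_mulVec hξ.memLp, hξ.cov, Matrix.mul_one, h, Matrix.zero_apply]

open scoped NNReal in
lemma hasLaw_mulVec [IsProbabilityMeasure P] (hξ : IsStdGaussian P ξ) {ι : Type*} [Fintype ι] [DecidableEq ι]
    {R : Matrix ι κ ℝ} {w : ι → ℝ≥0} (h : R * Rᵀ = diagonal fun i => (w i : ℝ)) :
    HasLaw (fun ω => R *ᵥ ξ ω) (Measure.pi fun i => gaussianReal 0 (w i)) P := by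
  have hG := hξ.hasGaussianLaw_mulVec R
  have hcov : ∀ i j, cov[fun ω => (R *ᵥ ξ ω) i, fun ω => (R *ᵥ ξ ω) j; P] =
      diagonal (fun i => (w i : ℝ)) i j := fun i j => by
    rw [cov_mulVec hξ.memLp, hξ.cov, Matrix.mul_one, h]
  refine iIndepFun.hasLaw_pi (X := fun i ω => (R *ᵥ ξ ω) i) (fun i => ⟨?_, ?_⟩)
    (HasGaussianLaw.iIndepFun_of_covariance_eq_zero (X := fun i ω => (R *ᵥ ξ ω) i) hG
      fun i j hij => ?_)
  · exact (hG.eval i).aemeasurable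
  · rw [(hG.eval i).map_eq_gaussianReal, ← covariance_self (hG.eval i).aemeasurable, hcov,
      diagonal_apply_eq, Real.toNNReal_coe]
    congr 1
    simp only [mulVec, dotProduct]
    rw [integral_finsetSum _ fun k _ => ((hξ.memLp k).integrable (by simp)).const_mul _]
    simp [integral_const_mul, hξ.mean]
  · exact (hcov i j).trans (diagonal_apply_ne _ hij)

end IsStdGaussian

lemma isStdGaussian_of_hasLaw_stdNormal {Ω : Type*} [MeasurableSpace Ω] {P : Measure Ω}
    [IsProbabilityMeasure P] {d : ℕ} {W : Ω → Fin d → ℝ} (hW : HasLaw W (stdNormal d) P) :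
    IsStdGaussian P W := by
  have hc : ∀ i, HasLaw (fun ω => W ω i) (gaussianReal 0 1) P := fun i =>
    (measurePreserving_eval (fun _ => gaussianReal 0 1) i).fun_comp_hasLaw hW
  have hind : iIndepFun (fun i ω => W ω i) P := (iIndepFun_iff_hasLaw_pi_pi hc).2 hW
  have hg : ∀ i, HasGaussianLaw (fun ω => W ω i) P := fun i => (hc i).hasGaussianLaw
  refine ⟨hind.hasGaussianLaw hg, fun k => ?_, ?_⟩
  · rw [(hc k).integral_eq]
    exact integral_id_gaussianReal
  · ext i j
    simp only [covMatrix, of_apply]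
    by_cases hij : i = j
    · subst hij
      rw [covariance_self (hc i).aemeasurable, (hc i).variance_eq, one_apply_eq,
        variance_id_gaussianReal, NNReal.coe_one]
    · rw [one_apply_ne hij]
      exact (hind.indepFun hij).covariance_eq_zero (hg i).memLp_two (hg j).memLp_two

/-- Stacking message and noise into one vector turns every signal of the loop into a matrix image of
it, so that independence becomes a matrix identity. -/
lemma IsStdGaussian.sumElim {Ω κ κ' : Type*} [MeasurableSpace Ω] [Fintype κ] [DecidableEq κ]
    [Fintype κ'] [DecidableEq κ'] {P : Measure Ω} [IsProbabilityMeasure P] {ξ : Ω → κ → ℝ}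
    {η : Ω → κ' → ℝ} (hξ : IsStdGaussian P ξ) (hη : IsStdGaussian P η) (h : IndepFun ξ η P) :
    IsStdGaussian P (fun ω => Sum.elim (ξ ω) (η ω)) where
  gaussian := (h.hasGaussianLaw hξ.gaussian hη.gaussian).map_fun
    (LinearMap.toContinuousLinearMap (LinearEquiv.sumArrowLequivProdArrow κ κ' ℝ ℝ).symm.toLinearMap)
  mean k := by
    rcases k with k | k
    · exact hξ.mean k
    · exact hη.mean k
  cov := by
    have hc : ∀ k k', cov[fun ω => ξ ω k, fun ω => η ω k'; P] = 0 := fun k k' =>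
      IndepFun.covariance_eq_zero
        (h.comp (measurable_pi_apply k) (measurable_pi_apply k')) (hξ.memLp k) (hη.memLp k')
    ext i j
    rcases i with i | i <;> rcases j with j | j
    · have := congrFun₂ hξ.cov i j
      simpa [covMatrix, Matrix.one_apply] using this
    · simpa [covMatrix] using hc i j
    · simpa [covMatrix, covariance_comm] using hc j i
    · have := congrFun₂ hη.cov i j
      simpa [covMatrix, Matrix.one_apply] using this

/-! ### Triangular structure of the closed loop -/

lemma encoderOutput_eq_mulVec {d : ℕ} (T : ℕ) (A : Matrix (Fin d) (Fin d) ℝ) (C w : Fin d → ℝ) :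
    encoderOutput T A C w = obsMatrix (T + 1) A C *ᵥ w := by
  have h : ∀ t, encoderState A w t = A ^ t *ᵥ w := fun t => by
    induction t with
    | zero => simp [encoderState]
    | succ t ih => rw [encoderState, ih, mulVec_mulVec, pow_succ']
  ext t
  rw [encoderOutput, h, dotProduct_mulVec]
  rfl

lemma Channel.Zmat_isLowerTriangular {m : ℕ} (ch : Channel m) (T : ℕ) :
    (ch.Zmat T).IsLowerTriangular := fun i j hij => by
  have : ¬ j ≤ i := not_le.2 hij
  simp [Channel.Zmat, toeplitz, this]

lemma Channel.det_Zmat {m : ℕ} (ch : Channel m) (T : ℕ) : (ch.Zmat T).det = 1 := by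
  rw [det_of_isLowerTriangular _ (ch.Zmat_isLowerTriangular T)]
  exact Finset.prod_eq_one fun i _ => by simp [Channel.Zmat, toeplitz, impulseResponse]

end FeedbackCoding

/-- A row of a causal matrix thus needs only the past coordinates of a signal, which are all that
the conditional mutual information sees. -/
lemma Fintype.sum_coe_of_eq_zero {ι : Type*} [Fintype ι] (s : Set ι) [Fintype s] (f : ι → ℝ)
    (h : ∀ i ∉ s, f i = 0) : ∑ i : s, f i = ∑ i, f i := by
  rw [Finset.sum_set_coe]
  exact Finset.sum_subset (Finset.subset_univ _) fun i _ hi => h i (by simpa using hi)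

namespace FeedbackCoding

/-- A causal factor times a strictly causal one is strictly causal: the loop is well posed and has
unit determinant for every generator. -/
lemma IsFeedbackGenerator.one_sub_mul {T : ℕ} {Gen M : Matrix (Fin (T + 1)) (Fin (T + 1)) ℝ}
    (hG : IsFeedbackGenerator Gen) (hM : M.IsLowerTriangular) :
    (1 - M * Gen).IsLowerTriangular ∧ (1 - M * Gen).det = 1 := by
  have h0 : ∀ i j, i ≤ j → (M * Gen) i j = 0 := fun i j hij => by
    rw [Matrix.mul_apply]
    refine Finset.sum_eq_zero fun k _ => ?_
    rcases le_or_gt k j with hk | hk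
    · rw [hG k j hk, mul_zero]
    · rw [hM (OrderDual.toDual_lt_toDual.2 (hij.trans_lt hk)), zero_mul]
  have hlow : (1 - M * Gen).IsLowerTriangular := fun i j hij => by
    have hij' : i < j := hij
    rw [Matrix.sub_apply, one_apply_ne hij'.ne, h0 i j hij'.le, sub_zero]
  refine ⟨hlow, ?_⟩
  rw [det_of_isLowerTriangular _ hlow]
  exact Finset.prod_eq_one fun i _ => by
    rw [Matrix.sub_apply, one_apply_eq, h0 i i le_rfl, sub_zero]

/-- The closed-loop response: the channel output as a function of the message and the noise. -/
lemma IsCodingLoop.output_eq {Ω : Type*} {m n T : ℕ} {ch : Channel m}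
    {A : Matrix (Fin (n + 1)) (Fin (n + 1)) ℝ} {C : Fin (n + 1) → ℝ}
    {Gen : Matrix (Fin (T + 1)) (Fin (T + 1)) ℝ}
    {W : Ω → Fin (n + 1) → ℝ} {N u y : Ω → Fin (T + 1) → ℝ}
    (h : IsCodingLoop ch A C Gen W N u y) (hdet : (1 - (ch.Zmat T)⁻¹ * Gen).det = 1) (ω : Ω) :
    y ω = (1 - (ch.Zmat T)⁻¹ * Gen)⁻¹ *ᵥ
      ((ch.Zmat T)⁻¹ *ᵥ encoderOutput T A C (W ω) + N ω) := by
  have h1 : (1 - (ch.Zmat T)⁻¹ * Gen) *ᵥ y ω =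
      (ch.Zmat T)⁻¹ *ᵥ encoderOutput T A C (W ω) + N ω := by
    rw [sub_mulVec, one_mulVec, ← mulVec_mulVec, sub_eq_iff_eq_add]
    nth_rw 1 [h.output ω]
    rw [h.input ω, mulVec_add]
    abel
  rw [← h1, mulVec_mulVec, nonsing_inv_mul _ (by simp [hdet]), one_mulVec]

/-! ### Directed information through innovations -/

/-- The directed information of a Gaussian feedback loop, in terms of the innovation variances
`w`. Signals are expressed through a standard Gaussian vector: `u = Q ξ`, `y = R ξ`,
`N = E ξ`; the innovations are `V y`. -/
lemma directedInfo_of_innovations {Ω κ : Type*} [MeasurableSpace Ω] [Fintype κ] [DecidableEq κ]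
    {P : Measure Ω} [IsProbabilityMeasure P] {T : ℕ} {ξ : Ω → κ → ℝ} (hξ : IsStdGaussian P ξ)
    {Q R E : Matrix (Fin (T + 1)) κ ℝ} {M V : Matrix (Fin (T + 1)) (Fin (T + 1)) ℝ}
    {w : Fin (T + 1) → NNReal} {u y N : Ω → Fin (T + 1) → ℝ}
    (hu : ∀ ω, u ω = Q *ᵥ ξ ω) (hy : ∀ ω, y ω = R *ᵥ ξ ω) (hN : ∀ ω, N ω = E *ᵥ ξ ω)
    (hyu : ∀ ω, y ω = M *ᵥ u ω + N ω) (hM : M.IsLowerTriangular)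
    (hV : V.IsLowerTriangular) (hV1 : ∀ i, V i i = 1) (hw : ∀ i, w i ≠ 0)
    (hVR : V * (R * Rᵀ) * Vᵀ = diagonal fun i => (w i : ℝ)) (hEE : E * Eᵀ = 1)
    (hRE : ∀ i j, i < j → (R * Eᵀ) i j = 0) (hQE : ∀ i j, i ≤ j → (Q * Eᵀ) i j = 0) :
    directedInfo P u y ≠ ∞ ∧
      (directedInfo P u y).toReal = ∑ t, 1 / 2 * Real.log (w t) := by
  have hVdet : V.det = 1 := by simp [det_of_isLowerTriangular _ hV, hV1]
  have huG : AEMeasurable u P := by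
    rw [show u = _ from funext hu]; exact (hξ.hasGaussianLaw_mulVec Q).aemeasurable
  have hyG : AEMeasurable y P := by
    rw [show y = _ from funext hy]; exact (hξ.hasGaussianLaw_mulVec R).aemeasurable
  have hNlaw : HasLaw N (Measure.pi fun _ => gaussianReal 0 1) P := by
    rw [show N = _ from funext hN]
    exact hξ.hasLaw_mulVec (w := fun _ => 1) (by simpa using hEE)
  have helaw : HasLaw (fun ω => V *ᵥ y ω) (Measure.pi fun i => gaussianReal 0 (w i)) P := by
    simp_rw [hy, mulVec_mulVec]
    refine hξ.hasLaw_mulVec ?_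
    rw [← hVR, transpose_mul]
    simp only [Matrix.mul_assoc]
  -- `R * (V * R)ᵀ` is the covariance of outputs with innovations. It equals `V⁻¹ * diagonal w`,
  -- which is lower triangular, so an innovation is uncorrelated with earlier outputs.
  have hVRR : ∀ i j, i < j → (R * (V * R)ᵀ) i j = 0 := fun i j hij => by
    have h1 : R * (V * R)ᵀ = V⁻¹ * diagonal fun i => (w i : ℝ) := by
      rw [← hVR, transpose_mul]
      simp only [Matrix.mul_assoc]
      rw [nonsing_inv_mul_cancel_left _ _ (by simp [hVdet])]
    rw [h1, mul_diagonal, (inv_isLowerTriangular hV hVdet).1 (OrderDual.toDual_lt_toDual.2 hij),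
      zero_mul]
  have step : ∀ t : Fin (T + 1),
      condMutualInfo P (fun ω (i : Set.Iic t) => u ω i) (fun ω => y ω t)
        (fun ω (i : Set.Iio t) => y ω i) ≠ ∞ ∧
      (condMutualInfo P (fun ω (i : Set.Iic t) => u ω i) (fun ω => y ω t)
        (fun ω (i : Set.Iio t) => y ω i)).toReal = 1 / 2 * Real.log (w t) := fun t => by
    have hX : AEMeasurable (fun ω (i : Set.Iic t) => u ω i) P :=
      (by fun_prop : Measurable fun (x : Fin (T + 1) → ℝ) (i : Set.Iic t) => x i)
        |>.comp_aemeasurable huG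
    have hZ : AEMeasurable (fun ω (i : Set.Iio t) => y ω i) P :=
      (by fun_prop : Measurable fun (x : Fin (T + 1) → ℝ) (i : Set.Iio t) => x i)
        |>.comp_aemeasurable hyG
    have hproj : Measurable fun x : Unit → ℝ => x () := measurable_pi_apply ()
    have hsplit : Measurable fun x : Set.Iio t ⊕ Set.Iic t → ℝ =>
        ((fun i : Set.Iio t => x (.inl i)), fun i : Set.Iic t => x (.inr i)) := by fun_prop
    have hind : IndepFun
        (fun ω => ((fun i : Set.Iio t => y ω i), (fun i : Set.Iic t => u ω i)))
        (fun ω => N ω t) P := by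
      have h := hξ.indepFun_mulVec
        (R := Matrix.of (Sum.elim (fun i : Set.Iio t => R i) fun i : Set.Iic t => Q i))
        (Q := Matrix.of fun _ : Unit => E t) (by
          ext i j
          rcases i with i | i
          · exact hRE i t i.2
          · exact hQE i t i.2)
      have h' := h.comp hsplit hproj
      convert h' using 1
      · ext ω i
        · exact congrFun (hy ω) i
        · exact congrFun (hu ω) i
      · ext ω
        exact congrFun (hN ω) t
    have hind' : IndepFun (fun ω (i : Set.Iio t) => y ω i) (fun ω => (V *ᵥ y ω) t) P := by
      have h := hξ.indepFun_mulVec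
        (R := Matrix.of fun i : Set.Iio t => R i)
        (Q := Matrix.of fun _ : Unit => (V * R) t) (by
          ext i j
          exact hVRR i t i.2)
      have h' := h.comp measurable_id hproj
      convert h' using 1
      · ext ω i
        exact congrFun (hy ω) i
      · ext ω
        rw [hy ω, mulVec_mulVec]
        rfl
    have key := condMutualInfo_of_gaussian_noise one_ne_zero (hw t) hX hZ
      ((measurePreserving_eval (fun _ => gaussianReal 0 1) t).fun_comp_hasLaw hNlaw)
      ((measurePreserving_eval (fun i => gaussianReal 0 (w i)) t).fun_comp_hasLaw helaw)
      hind hind' (Y := fun ω => y ω t)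
      -- `h` is the one-step predictor, obtained by solving row `t` of `e = V y` for `y_t` with `V t
      -- t = 1`.
      (g := fun x => ∑ j : Set.Iic t, M t j * x j)
      (h := fun z => -∑ j : Set.Iio t, V t j * z j)
      (by fun_prop) (by fun_prop)
      (fun ω => by
        rw [Fintype.sum_coe_of_eq_zero (Set.Iic t) (fun j => M t j * u ω j) fun j hj => by
          rw [hM (OrderDual.toDual_lt_toDual.2 (not_le.1 hj)), zero_mul]]
        exact congrFun (hyu ω) t)
      (fun ω => by
        -- Subtracting the diagonal term `y_t` makes the summand vanish at `j = t` too, so the sum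
        -- lives on the strict past.
        have h := Fintype.sum_coe_of_eq_zero (Set.Iio t)
          (fun j => V t j * y ω j - if j = t then y ω t else 0) fun j hj => by
            rcases (not_lt.1 fun h : j < t => hj h).eq_or_lt with rfl | hj
            · simp [hV1]
            · rw [hV (OrderDual.toDual_lt_toDual.2 hj), zero_mul, if_neg hj.ne', sub_zero]
        have h2 : ∀ j : Set.Iio t, V t j * y ω j - (if (j : Fin (T + 1)) = t then y ω t else 0) =
            V t j * y ω j := fun j => by rw [if_neg (ne_of_lt j.2), sub_zero]
        simp only [h2, Finset.sum_sub_distrib, Finset.sum_ite_eq', Finset.mem_univ, if_true] at h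
        rw [h]
        change y ω t = -((V *ᵥ y ω) t - y ω t) + (V *ᵥ y ω) t
        ring)
    simpa using key
  have hd : directedInfo P u y = ∑ t, condMutualInfo P (fun ω (i : Set.Iic t) => u ω i)
      (fun ω => y ω t) (fun ω (i : Set.Iio t) => y ω i) := rfl
  rw [hd, ENNReal.toReal_sum fun t _ => (step t).1]
  exact ⟨ENNReal.sum_ne_top.2 fun t _ => (step t).1, Finset.sum_congr rfl fun t _ => (step t).2⟩

end FeedbackCoding

/-! ### Evaluation of the coding loop -/

namespace FeedbackCoding

/-- All information quantities of the coding loop, evaluated. -/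
theorem IsCodingLoop.information_eq {Ω : Type*} [MeasurableSpace Ω] {P : Measure Ω}
    [IsProbabilityMeasure P] {m n T : ℕ} {ch : Channel m}
    {A : Matrix (Fin (n + 1)) (Fin (n + 1)) ℝ} {C : Fin (n + 1) → ℝ}
    {Gen : Matrix (Fin (T + 1)) (Fin (T + 1)) ℝ}
    {W : Ω → Fin (n + 1) → ℝ} {N u y : Ω → Fin (T + 1) → ℝ}
    (hW : HasLaw W (stdNormal (n + 1)) P) (hN : HasLaw N (stdNormal (T + 1)) P)
    (hWN : IndepFun W N P) (hG : IsFeedbackGenerator Gen)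
    (hloop : IsCodingLoop ch A C Gen W N u y) :
    0 < (covMatrix P y).det ∧
      (covMatrix P y).det = (1 + (ch.Zmat T)⁻¹ *
        (obsMatrix (T + 1) A C * (obsMatrix (T + 1) A C)ᵀ) * ((ch.Zmat T)⁻¹)ᵀ).det ∧
      (mutualInfo P W y : EReal) = ((1 / 2 * Real.log (covMatrix P y).det : ℝ) : EReal) ∧
      (mutualInfo P (fun ω => encoderOutput T A C (W ω)) y : EReal) =
        ((1 / 2 * Real.log (covMatrix P y).det : ℝ) : EReal) ∧
      (directedInfo P u y : EReal) =
        ((1 / 2 * Real.log (covMatrix P y).det : ℝ) : EReal) := by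
  set M := (ch.Zmat T)⁻¹
  set Γ := obsMatrix (T + 1) A C
  have hMlow : M.IsLowerTriangular :=
    (inv_isLowerTriangular (ch.Zmat_isLowerTriangular T) (ch.det_Zmat T)).1
  obtain ⟨hKlow, hKdet⟩ := hG.one_sub_mul hMlow
  set L := (1 - M * Gen)⁻¹
  obtain ⟨hLlow, hLdet⟩ : L.IsLowerTriangular ∧ L.det = 1 := inv_isLowerTriangular hKlow hKdet
  have hyL : ∀ ω, y ω = L *ᵥ (M *ᵥ (Γ *ᵥ W ω) + N ω) := fun ω => by
    rw [hloop.output_eq hKdet, encoderOutput_eq_mulVec]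
  let ξ : Ω → Fin (n + 1) ⊕ Fin (T + 1) → ℝ := fun ω => Sum.elim (W ω) (N ω)
  have hξ : IsStdGaussian P ξ :=
    (isStdGaussian_of_hasLaw_stdNormal hW).sumElim (isStdGaussian_of_hasLaw_stdNormal hN) hWN
  -- The block columns refer to message and noise; `R`, `E` and `Q` represent `y`, `N` and `u`.
  let R := fromCols (L * (M * Γ)) L
  let E := fromCols (0 : Matrix (Fin (T + 1)) (Fin (n + 1)) ℝ)
    (1 : Matrix (Fin (T + 1)) (Fin (T + 1)) ℝ)
  let Q := fromCols Γ 0 + Gen * R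
  have hy : ∀ ω, y ω = R *ᵥ ξ ω := fun ω => by
    simp only [R, ξ, fromCols_mulVec, Sum.elim_comp_inl, Sum.elim_comp_inr]
    rw [hyL, mulVec_add]
    simp only [mulVec_mulVec]
  have hNE : ∀ ω, N ω = E *ᵥ ξ ω := fun ω => by
    simp only [E, ξ, fromCols_mulVec, Sum.elim_comp_inl, Sum.elim_comp_inr, zero_mulVec,
      one_mulVec, zero_add]
  have hu : ∀ ω, u ω = Q *ᵥ ξ ω := fun ω => by
    rw [hloop.input, encoderOutput_eq_mulVec, add_mulVec, ← mulVec_mulVec, ← hy]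
    simp only [ξ, fromCols_mulVec, Sum.elim_comp_inl, Sum.elim_comp_inr, zero_mulVec, add_zero]
    rfl
  have hS : covMatrix P y = R * Rᵀ := by
    rw [show y = fun ω => R *ᵥ ξ ω from funext hy, hξ.covMatrix_mulVec]
  have hRR : R * Rᵀ = L * (1 + M * (Γ * Γᵀ) * Mᵀ) * Lᵀ := by
    simp only [R, transpose_fromCols, fromCols_mul_fromRows, transpose_mul, Matrix.mul_add,
      Matrix.add_mul, Matrix.mul_one, Matrix.mul_assoc]
    exact add_comm _ _
  have hpos : (1 + M * (Γ * Γᵀ) * Mᵀ).PosDef := by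
    refine PosDef.one.add_posSemidef ?_
    have h := posSemidef_self_mul_conjTranspose (M * Γ)
    rw [conjTranspose_eq_transpose_of_trivial, transpose_mul] at h
    simpa only [Matrix.mul_assoc] using h
  have hdetS : (R * Rᵀ).det = (1 + M * (Γ * Γᵀ) * Mᵀ).det := by
    rw [hRR, det_mul, det_mul, det_transpose, hLdet, one_mul, mul_one]
  have hSpos : (R * Rᵀ).PosDef := by
    have h := hpos.mul_mul_conjTranspose_same (B := L)
      (vecMul_injective_iff_isUnit.2 ((isUnit_iff_isUnit_det L).2 (by rw [hLdet]; exact isUnit_one)))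
    rwa [conjTranspose_eq_transpose_of_trivial, ← hRR] at h
  obtain ⟨V, w, hVlow, hVdet, hV1, hw, hVS⟩ := hSpos.exists_isLowerTriangular_conj_eq_diagonal
  have hdetw : (R * Rᵀ).det = ∏ i, (w i : ℝ) := by
    have h := congrArg Matrix.det hVS
    rwa [det_mul, det_mul, det_transpose, hVdet, one_mul, mul_one, det_diagonal] at h
  have hlog : ∑ i, 1 / 2 * Real.log (w i) = 1 / 2 * Real.log (R * Rᵀ).det := by
    rw [hdetw, Real.log_prod fun i _ => NNReal.coe_ne_zero.2 (hw i), Finset.mul_sum]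
  have helaw : HasLaw (fun ω => V *ᵥ y ω) (Measure.pi fun i => gaussianReal 0 (w i)) P := by
    simp_rw [hy, mulVec_mulVec]
    refine hξ.hasLaw_mulVec ?_
    rw [← hVS, transpose_mul]
    simp only [Matrix.mul_assoc]
  -- Equality in `EReal` with a real number records finiteness as well as the value.
  have hcoe : ∀ {I : ℝ≥0∞}, I ≠ ∞ → I.toReal = ∑ i, 1 / 2 * Real.log (w i) →
      (I : EReal) = ((1 / 2 * Real.log (R * Rᵀ).det : ℝ) : EReal) := fun {I} hI h => by
    rw [← hlog, ← h, EReal.coe_ennreal_toReal hI]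
  have hmul : ∀ {k l : ℕ} (B : Matrix (Fin k) (Fin l) ℝ), Measurable fun x => B *ᵥ x := fun B =>
    (continuous_const.matrix_mulVec continuous_id).measurable
  rw [hS]
  refine ⟨hSpos.det_pos, hdetS, ?_, ?_, ?_⟩
  · have h := mutualInfo_of_gaussian_noise (fun _ => one_ne_zero) hw hW.aemeasurable hN helaw hWN
      (g := fun x => M *ᵥ (Γ *ᵥ x)) ((hmul M).comp (hmul Γ)) hLdet hVdet hyL fun _ => rfl
    exact hcoe h.1 (by simpa using h.2)
  · have hr : Measurable (encoderOutput T A C) := by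
      rw [show encoderOutput T A C = fun x => Γ *ᵥ x from
        funext fun x => encoderOutput_eq_mulVec T A C x]
      exact hmul Γ
    have h := mutualInfo_of_gaussian_noise (X := fun ω => encoderOutput T A C (W ω))
      (fun _ => one_ne_zero) hw (hr.comp_aemeasurable hW.aemeasurable) hN helaw (hWN.comp hr measurable_id)
      (hmul M) hLdet hVdet (hloop.output_eq hKdet) fun _ => rfl
    exact hcoe h.1 (by simpa using h.2)
  -- The covariance of `y` with `N` is the lower triangular `L`: earlier outputs are uncorrelated
  -- with later noise.
  · have hRE : R * Eᵀ = L := by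
      simp [R, E, transpose_fromCols, fromCols_mul_fromRows]
    have hLE : ∀ i j, i < j → (R * Eᵀ) i j = 0 := fun i j hij => by
      rw [hRE]
      exact hLlow (OrderDual.toDual_lt_toDual.2 hij)
    have h := directedInfo_of_innovations hξ hu hy hNE hloop.output hMlow hVlow hV1 hw hVS
      (by simp [E, transpose_fromCols, fromCols_mul_fromRows]) hLE (fun i j hij => by
        -- The encoder output is uncorrelated with the noise, so only the feedback contributes.
        -- Strictness of `Gen` gives zero at `i = j` too: `u_t` is uncorrelated with `N_t`.
        have h1 : Q * Eᵀ = Gen * (R * Eᵀ) := by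
          simp only [Q, Matrix.add_mul, Matrix.mul_assoc]
          simp [E, transpose_fromCols, fromCols_mul_fromRows]
        rw [h1, Matrix.mul_apply]
        refine Finset.sum_eq_zero fun k _ => ?_
        rcases le_or_gt i k with hk | hk
        · rw [hG i k hk, zero_mul]
        · rw [hLE k j (hk.trans_le hij), mul_zero])
    exact hcoe h.1 h.2

end FeedbackCoding

theorem mainTheorem6 {Ω : Type*} [MeasurableSpace Ω] (P : Measure Ω) [IsProbabilityMeasure P]
    {m n T : ℕ} (hnT : n ≤ T) (ch : FeedbackCoding.Channel m)
    (A : Matrix (Fin (n + 1)) (Fin (n + 1)) ℝ) (C : Fin (n + 1) → ℝ)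
    (hAC : FeedbackCoding.IsAdmissibleEncoder ch A C)
    (W : Ω → Fin (n + 1) → ℝ) (N : Ω → Fin (T + 1) → ℝ)
    (hW : HasLaw W (FeedbackCoding.stdNormal (n + 1)) P)
    (hN : HasLaw N (FeedbackCoding.stdNormal (T + 1)) P)
    (hWN : IndepFun W N P) :
    -- the chain of equalities, for every feedback generator
    (∀ (Gen : Matrix (Fin (T + 1)) (Fin (T + 1)) ℝ) (u y : Ω → Fin (T + 1) → ℝ),
      FeedbackCoding.IsFeedbackGenerator Gen →
      FeedbackCoding.IsCodingLoop ch A C Gen W N u y →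
      FeedbackCoding.mutualInfo P W y =
          FeedbackCoding.mutualInfo P (fun ω => FeedbackCoding.encoderOutput T A C (W ω)) y ∧
      FeedbackCoding.mutualInfo P (fun ω => FeedbackCoding.encoderOutput T A C (W ω)) y =
          FeedbackCoding.directedInfo P u y ∧
      0 < (FeedbackCoding.covMatrix P y).det ∧
      (FeedbackCoding.directedInfo P u y : EReal) =
          ((1 / 2 * Real.log (FeedbackCoding.covMatrix P y).det : ℝ) : EReal) ∧
      1 / 2 * Real.log (FeedbackCoding.covMatrix P y).det =
          1 / 2 * Real.log (1 + (ch.Zmat T)⁻¹ *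
            FeedbackCoding.covMatrix P (fun ω => FeedbackCoding.encoderOutput T A C (W ω)) *
            ((ch.Zmat T)⁻¹)ᵀ).det ∧
      1 / 2 * Real.log (1 + (ch.Zmat T)⁻¹ *
            FeedbackCoding.covMatrix P (fun ω => FeedbackCoding.encoderOutput T A C (W ω)) *
            ((ch.Zmat T)⁻¹)ᵀ).det =
          1 / 2 * Real.log (1 + (ch.Zmat T)⁻¹ *
            (FeedbackCoding.obsMatrix (T + 1) A C * (FeedbackCoding.obsMatrix (T + 1) A C)ᵀ) *
            ((ch.Zmat T)⁻¹)ᵀ).det ∧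
      0 < (1 + (ch.Zmat T)⁻¹ *
            FeedbackCoding.covMatrix P (fun ω => FeedbackCoding.encoderOutput T A C (W ω)) *
            ((ch.Zmat T)⁻¹)ᵀ).det ∧
      0 < (1 + (ch.Zmat T)⁻¹ *
            (FeedbackCoding.obsMatrix (T + 1) A C * (FeedbackCoding.obsMatrix (T + 1) A C)ᵀ) *
            ((ch.Zmat T)⁻¹)ᵀ).det) ∧
    -- the common value does not depend on the feedback generator
    (∀ (Gen Gen' : Matrix (Fin (T + 1)) (Fin (T + 1)) ℝ) (u y u' y' : Ω → Fin (T + 1) → ℝ),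
      FeedbackCoding.IsFeedbackGenerator Gen →
      FeedbackCoding.IsFeedbackGenerator Gen' →
      FeedbackCoding.IsCodingLoop ch A C Gen W N u y →
      FeedbackCoding.IsCodingLoop ch A C Gen' W N u' y' →
      FeedbackCoding.mutualInfo P W y = FeedbackCoding.mutualInfo P W y') := by
  have hcovr : FeedbackCoding.covMatrix P
      (fun ω => FeedbackCoding.encoderOutput T A C (W ω)) =
      FeedbackCoding.obsMatrix (T + 1) A C * (FeedbackCoding.obsMatrix (T + 1) A C)ᵀ := by
    simp_rw [FeedbackCoding.encoderOutput_eq_mulVec]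
    exact (FeedbackCoding.isStdGaussian_of_hasLaw_stdNormal hW).covMatrix_mulVec _
  rw [hcovr]
  refine ⟨fun Gen u y hG hloop => ?_, fun Gen Gen' u y u' y' hG hG' hloop hloop' => ?_⟩
  · obtain ⟨hpos, hdet, h1, h2, h3⟩ := hloop.information_eq hW hN hWN hG
    exact ⟨EReal.coe_ennreal_injective (h1.trans h2.symm),
      EReal.coe_ennreal_injective (h2.trans h3.symm), hpos, h3, by rw [hdet], rfl,
      hdet ▸ hpos, hdet ▸ hpos⟩
  · obtain ⟨-, hdet, h1, -⟩ := hloop.information_eq hW hN hWN hG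
    obtain ⟨-, hdet', h1', -⟩ := hloop'.information_eq hW hN hWN hG'
    -- Both values are half the logarithm of the same determinant, in which the generator does not
    -- occur.
    refine EReal.coe_ennreal_injective (h1.trans ?_)
    rw [h1', hdet, hdet']
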